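/- Let $\Delta^+=\{z\in\mathbb C: |z|<1,\ \operatorname{Im} z>0\}$, and let $f:\overline{\Delta^+}\to\mathbb C$ be holomorphic on $\Delta^+$ and $C^\infty$-smooth on $\overline{\Delta^+}$ (up to the boundary). Suppose that $f(x)\in\Gamma_\infty:=(\mathbb C\setminus i\mathbb R)\cup\{0\}$ for every $x\in(-1,1)$, and that the set of zeros of $f$ in $(-1,1)$ has no limit point in $(-1,1)$ other than possibly $0$ (so every zero of $f$ in $(-1,1)\setminus\{0\}$ is isolated among the zeros of $f$ in $(-1,1)$). If $f$ vanishes to infinite order at $0$, i.e. $\lim_{\Delta^+\ni z\to 0} f(z)/|z|^N=0$ for every $N\in\mathbb N$, then $f\equiv 0$ on $\overline{\Delta^+}$. The same holds if $\Gamma_\infty$ is replaced by $(\mathbb C\setminus L)\cup\{0\}$, where $L\subset\mathbb C$ is any real line through the origin. -/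

import Mathlib

open scoped ContDiff

namespace BoundaryUnique

/-- The open upper half-disc `Δ⁺ = {z : |z| < 1, Im z > 0}`. -/
def upperHalfDisc : Set ℂ := {z | ‖z‖ < 1 ∧ 0 < z.im}

/-- The imaginary axis `iℝ`. -/
def imaginaryAxis : Set ℂ := {z | z.re = 0}

/-- `Γ_∞ = (ℂ ∖ iℝ) ∪ {0}`. -/
def gammaInfty : Set ℂ := imaginaryAxisᶜ ∪ {0}

/-- The zeros of `f` on the interval `(-1, 1)`, as real numbers. -/
def realZeros (f : ℂ → ℂ) : Set ℝ := {x | x ∈ Set.Ioo (-1 : ℝ) 1 ∧ f (x : ℂ) = 0}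

/-- `f` vanishes to infinite order at `a`, along `Ω`: for every `N`,
`f(z) / |z - a|^N → 0` as `z → a` with `z ∈ Ω`. -/
def VanishesToInfiniteOrder (f : ℂ → ℂ) (Ω : Set ℂ) (a : ℂ) : Prop :=
  ∀ N : ℕ, Filter.Tendsto (fun z : ℂ => f z / ((‖z - a‖ ^ N : ℝ) : ℂ))
    (nhdsWithin a Ω) (nhds 0)

end BoundaryUnique

/-!
After a rotation, `Re f` vanishes on `(-1, 1)` only where `f` does. If `Re f` had constant sign
there, the proof would be short: by Cauchy's theorem the even moments `∫ Re f(x) x ^ (-2n) dx` over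
`[-1/2, 1/2]`, finite by flatness, equal integrals over a contour in `‖z‖ ≥ 1/2` and are `O(4 ^ n)`,
whereas a nonnegative `Re f` that is positive at a point `x₀` with `|x₀| < 1/2` gives them growth
of the order of `ρ ^ (-2n)` with some `ρ < 1/2`. So `f` vanishes on `(-1/2, 1/2)`, and then
everywhere (`eq_zero_of_zero_on_boundary_interval`).

In general `Re f` changes sign at zeros of `f`, possibly infinitely often near the origin. The sign
changes outside `(-δ, δ)` are finitely many and are removed by a real rational multiplier with
alternating simple zeros and poles at them, `nodeQuotient` (`exists_nodeQuotient_sign_re`). What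
makes the argument uniform in `δ` is that the zeros and poles interlace: for real points `t` the
distance `‖z - t‖` is unimodal in `t`, so the multiplier telescopes and its norm lies between `m`
and `1 / m`, where `m ≤ 1` is any lower bound for `‖z - t‖ / 2`, regardless of the number of points
(`norm_nodeQuotient_mem_Icc`). Three consequences follow:

* the multiplier is `O(1 / Im z)`, which the weight `1/4 - z²` offsets at the corners `±1/2` of the
  contour (`exists_norm_integral_momentIntegrand_le`);
* it is at most `2 / ‖z - t‖` for the nearest zero `t`, so that, `f'` being flat as well, its
  product with `f` is flat with constants independent of `δ`
  (`exists_norm_mul_nodeQuotient_le_pow`), and the interval `(-δ, δ)` contributes `O(δ)`;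
* near a point where `f ≠ 0` it is bounded below.

Taking `n` large first and then `δ` small gives the contradiction of the constant-sign case
(`eq_zero_of_abs_lt_half`).
-/

namespace BoundaryUnique

variable {f : ℂ → ℂ}

/-! ### Alternating quotients of linear factors -/

/-- For `l = [t₁, t₂, t₃, …]`, the rational function
`((z - t₁) / 2) ((z - t₃) / 2) ⋯ / (((z - t₂) / 2) ((z - t₄) / 2) ⋯)`. The factors are halved so
that they have norm at most `1` when all points lie in the unit disc. -/
noncomputable def nodeQuotient : List ℝ → ℂ → ℂ
  | [], _ => 1
  | t :: l, z => ((z - t) / 2) / nodeQuotient l z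

lemma nodeQuotient_ne_zero {l : List ℝ} {z : ℂ} (h : ∀ t ∈ l, z ≠ t) :
    nodeQuotient l z ≠ 0 := by
  induction l with
  | nil => simp [nodeQuotient]
  | cons t l ih =>
    simp only [List.mem_cons, forall_eq_or_imp] at h
    exact div_ne_zero (div_ne_zero (sub_ne_zero.2 h.1) two_ne_zero) (ih h.2)

lemma differentiableAt_nodeQuotient {l : List ℝ} {z : ℂ} (h : ∀ t ∈ l, z ≠ t) :
    DifferentiableAt ℂ (nodeQuotient l) z := by
  induction l with
  | nil => exact differentiableAt_const (1 : ℂ)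
  | cons t l ih =>
    simp only [List.mem_cons, forall_eq_or_imp] at h
    have : nodeQuotient (t :: l) = fun z => ((z - t) / 2) / nodeQuotient l z := rfl
    rw [this]
    exact ((differentiableAt_id.sub_const _).div_const _).div (ih h.2) (nodeQuotient_ne_zero h.2)

lemma norm_nodeQuotient_cons (t : ℝ) (l : List ℝ) (z : ℂ) :
    ‖nodeQuotient (t :: l) z‖ = ‖z - t‖ / 2 / ‖nodeQuotient l z‖ := by
  simp [nodeQuotient]

/-- When the distances to `z` increase along the list, the quotient telescopes to a number
between the first factor and `1`. -/
lemma norm_nodeQuotient_of_monotone {z : ℂ} (l : List ℝ) (h : ℝ)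
    (hp : (h :: l).Pairwise fun a b : ℝ => ‖z - a‖ ≤ ‖z - b‖)
    (hpos : ∀ t ∈ h :: l, 0 < ‖z - t‖) (hle : ∀ t ∈ h :: l, ‖z - t‖ / 2 ≤ 1) :
    ‖z - h‖ / 2 ≤ ‖nodeQuotient (h :: l) z‖ ∧ ‖nodeQuotient (h :: l) z‖ ≤ 1 := by
  induction l generalizing h with
  | nil =>
    simp only [List.mem_singleton, forall_eq] at hle
    simp [nodeQuotient, hle]
  | cons k l ih =>
    rw [List.pairwise_cons] at hp
    have ih' := ih k hp.2 (fun t ht => hpos t (List.mem_cons_of_mem _ ht))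
      (fun t ht => hle t (List.mem_cons_of_mem _ ht))
    have hk : 0 < ‖z - k‖ := hpos k (by simp)
    have hh : 0 < ‖z - h‖ := hpos h (by simp)
    have hhk : ‖z - h‖ ≤ ‖z - k‖ := hp.1 k (by simp)
    have hq : 0 < ‖nodeQuotient (k :: l) z‖ := lt_of_lt_of_le (by positivity) ih'.1
    rw [norm_nodeQuotient_cons]
    constructor
    · rw [le_div_iff₀ hq]
      exact mul_le_of_le_one_right (by positivity) ih'.2
    · rw [div_le_one hq]
      linarith [ih'.1]

lemma sq_norm_sub_ofReal (z : ℂ) (t : ℝ) : ‖z - t‖ ^ 2 = (z.re - t) ^ 2 + z.im ^ 2 := by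
  rw [Complex.sq_norm, Complex.normSq_apply]; simp; ring

lemma le_norm_nodeQuotient {z : ℂ} {m : ℝ} (hm : 0 < m) (hm1 : m ≤ 1) : ∀ (l : List ℝ),
    l.Pairwise (· > ·) → (∀ t ∈ l, m ≤ ‖z - t‖ / 2) → (∀ t ∈ l, ‖z - t‖ / 2 ≤ 1) →
    m ≤ ‖nodeQuotient l z‖
  | [], _, _, _ => by simpa [nodeQuotient] using hm1
  | [t], _, hd, _ => by simpa [nodeQuotient] using hd t (by simp)
  | t :: h :: l, hl, hd, hle => by
    have hl' := List.pairwise_cons.1 hl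
    have hl'' := List.pairwise_cons.1 hl'.2
    have ht : m ≤ ‖z - t‖ / 2 := hd t (by simp)
    have hh : m ≤ ‖z - h‖ / 2 := hd h (by simp)
    have hpos : ∀ s ∈ h :: l, 0 < ‖z - s‖ := fun s hs => by
      linarith [hd s (List.mem_cons_of_mem _ hs)]
    have hq : 0 < ‖nodeQuotient (h :: l) z‖ := norm_pos_iff.2 <| nodeQuotient_ne_zero
      fun s hs => sub_ne_zero.1 (norm_pos_iff.1 (hpos s hs))
    rw [norm_nodeQuotient_cons, le_div_iff₀ hq]
    by_cases hc : ‖z - h‖ ≤ ‖z - t‖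
    · -- The distances decrease here, and `h` cancels against `t`.
      have ih := le_norm_nodeQuotient hm hm1 l hl''.2
        (fun s hs => hd s (by simp [hs])) (fun s hs => hle s (by simp [hs]))
      rw [norm_nodeQuotient_cons, mul_div_assoc', div_le_iff₀ (hm.trans_le ih)]
      nlinarith
    · -- The point `t` is already beyond `z`, and the distances increase along the rest.
      rw [not_le] at hc
      have hth : h < t := hl'.1 h (by simp)
      have h1 := sq_lt_sq₀ (norm_nonneg _) (norm_nonneg _) |>.2 hc
      rw [sq_norm_sub_ofReal, sq_norm_sub_ofReal] at h1
      have h2 : h < z.re := by nlinarith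
      have hp : (h :: l).Pairwise fun a b : ℝ => ‖z - a‖ ≤ ‖z - b‖ := by
        refine hl'.2.imp_of_mem fun {a b} ha _ hab => ?_
        have ha' : a ≤ h := by
          rcases List.mem_cons.1 ha with rfl | ha
          · exact le_rfl
          · exact (hl''.1 a ha).le
        refine (sq_le_sq₀ (norm_nonneg _) (norm_nonneg _)).1 ?_
        rw [sq_norm_sub_ofReal, sq_norm_sub_ofReal]
        have : b < a := hab
        nlinarith
      have := (norm_nodeQuotient_of_monotone l h hp hpos
        fun s hs => hle s (List.mem_cons_of_mem _ hs)).2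
      nlinarith

/-- The distance from `z` to a real point `t` is a unimodal function of `t`. So the alternating
quotient over a decreasing list of points telescopes on both sides of the nearest point, and it is
controlled by the smallest factor alone, whatever the number of points. -/
lemma norm_nodeQuotient_mem_Icc {z : ℂ} {m : ℝ} (hm : 0 < m) (hm1 : m ≤ 1) (l : List ℝ)
    (hl : l.Pairwise (· > ·)) (hd : ∀ t ∈ l, m ≤ ‖z - t‖ / 2) (hle : ∀ t ∈ l, ‖z - t‖ / 2 ≤ 1) :
    ‖nodeQuotient l z‖ ∈ Set.Icc m (1 / m) := by
  refine ⟨le_norm_nodeQuotient hm hm1 l hl hd hle, ?_⟩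
  match l, hl, hd, hle with
  | [], _, _, _ => simpa [nodeQuotient] using (one_le_inv₀ hm).2 hm1
  | t :: l, hl, hd, hle =>
    rw [norm_nodeQuotient_cons]
    exact div_le_div₀ zero_le_one (hle t (by simp)) hm <|
      le_norm_nodeQuotient hm hm1 l (List.pairwise_cons.1 hl).2
        (fun s hs => hd s (List.mem_cons_of_mem _ hs)) fun s hs => hle s (List.mem_cons_of_mem _ hs)

lemma im_nodeQuotient_ofReal (l : List ℝ) (x : ℝ) : (nodeQuotient l x).im = 0 := by
  induction l with
  | nil => simp [nodeQuotient]
  | cons t l ih =>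
    simp [nodeQuotient, Complex.div_im, ih]

lemma re_nodeQuotient_cons_ofReal (t : ℝ) (l : List ℝ) (x : ℝ) :
    (nodeQuotient (t :: l) x).re = (x - t) / 2 / (nodeQuotient l x).re := by
  have h : nodeQuotient l x = ((nodeQuotient l x).re : ℂ) :=
    Complex.ext rfl (by simp [im_nodeQuotient_ofReal])
  have : nodeQuotient (t :: l) x = (((x - t) / 2 / (nodeQuotient l x).re : ℝ) : ℂ) := by
    rw [nodeQuotient, h]; push_cast; simp
  rw [this, Complex.ofReal_re]

lemma re_nodeQuotient_pos (l : List ℝ) (x : ℝ) (h : ∀ t ∈ l, t < x) :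
    0 < (nodeQuotient l x).re := by
  induction l with
  | nil => simp [nodeQuotient]
  | cons t l ih =>
    simp only [List.mem_cons, forall_eq_or_imp] at h
    rw [re_nodeQuotient_cons_ofReal]
    exact div_pos (by linarith [h.1]) (ih h.2)

/-- A real function that changes sign only at points of a finite set `S` has, up to a global sign,
the sign of the alternating quotient over the points at which it does change sign. -/
lemma exists_nodeQuotient_sign (S : Finset ℝ) : ∀ (D : Set ℝ) (h : ℝ → ℝ),
    (∀ x ∈ D, ∀ y ∈ D, x ≤ y → (∀ s ∈ S, s ∉ Set.Icc x y) → 0 < h x * h y) →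
    (∀ x ∈ D, x ∉ S) →
    ∃ (l : List ℝ) (σ : ℝ), l.Pairwise (· > ·) ∧ (∀ t ∈ l, t ∈ S) ∧ (σ = 1 ∨ σ = -1) ∧
      ∀ x ∈ D, 0 < σ * (h x * (nodeQuotient l x).re) := by
  induction S using Finset.induction_on_max with
  | empty =>
    intro D h hD _
    by_cases hx : ∃ x ∈ D, h x < 0
    · obtain ⟨x, hx, hneg⟩ := hx
      refine ⟨[], -1, by simp, by simp, by simp, fun y hy => ?_⟩
      simp only [nodeQuotient, Complex.one_re]
      rcases le_total x y with hxy | hxy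
      · nlinarith [hD x hx y hy hxy (by simp)]
      · nlinarith [hD y hy x hx hxy (by simp)]
    · push Not at hx
      refine ⟨[], 1, by simp, by simp, by simp, fun y hy => ?_⟩
      simp only [nodeQuotient, Complex.one_re]
      nlinarith [hD y hy y hy le_rfl (by simp), hx y hy]
  | insert s S hs ih =>
    intro D h hD hDS
    obtain ⟨l, σ, hl, hlS, hσ, hpos⟩ := ih (D ∩ Set.Iio s) h
      (fun x hx y hy hxy hS => hD x hx.1 y hy.1 hxy <| by
        intro t ht
        rcases Finset.mem_insert.1 ht with rfl | ht
        · exact fun h => absurd hy.2 (not_lt.2 h.2)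
        · exact hS t ht)
      (fun x hx hxS => hDS x hx.1 (Finset.mem_insert_of_mem hxS))
    have hright : ∀ x ∈ D, ∀ y ∈ D, s < x → s < y → 0 < h x * h y := by
      have key : ∀ x ∈ D, ∀ y ∈ D, s < x → x ≤ y → 0 < h x * h y := by
        intro x hx y hy hsx hxy
        refine hD x hx y hy hxy fun t ht htI => ?_
        rcases Finset.mem_insert.1 ht with rfl | ht
        · exact absurd hsx (not_lt.2 htI.1)
        · linarith [hs t ht, htI.1]
      intro x hx y hy hsx hsy
      rcases le_total x y with hxy | hxy
      · exact key x hx y hy hsx hxy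
      · rw [mul_comm]; exact key y hy x hx hsy hxy
    have hlpos : ∀ x, s < x → 0 < (nodeQuotient l x).re := fun x hx =>
      re_nodeQuotient_pos l x fun t ht => (hs t (hlS t ht)).trans hx
    have hcase : ∀ x ∈ D, x < s ∨ s < x := fun x hx =>
      lt_or_gt_of_ne fun h => hDS x hx (h ▸ Finset.mem_insert_self _ _)
    -- To the right of `s` the sign is constant; `s` joins the list if it is the wrong one.
    by_cases hx : ∃ x ∈ D, s < x ∧ σ * h x < 0
    · obtain ⟨x, hx, hsx, hneg⟩ := hx
      refine ⟨s :: l, -σ, List.pairwise_cons.2 ⟨fun t ht => hs t (hlS t ht), hl⟩, ?_, ?_,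
        fun y hy => ?_⟩
      · intro t ht
        rcases List.mem_cons.1 ht with rfl | ht
        · exact Finset.mem_insert_self _ _
        · exact Finset.mem_insert_of_mem (hlS t ht)
      · rcases hσ with rfl | rfl <;> simp
      · rw [re_nodeQuotient_cons_ofReal]
        rcases hcase y hy with hys | hys
        · have h1 := hpos y ⟨hy, hys⟩
          have h0 : (nodeQuotient l y).re ≠ 0 := by
            intro h0; simp [h0] at h1
          have : -σ * (h y * ((y - s) / 2 / (nodeQuotient l y).re)) =
              σ * (h y * (nodeQuotient l y).re) * ((s - y) / 2 / (nodeQuotient l y).re ^ 2) := by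
            field_simp; ring
          rw [this]
          exact mul_pos h1 (div_pos (by linarith) (by positivity))
        · have h1 : 0 < (y - s) / 2 / (nodeQuotient l y).re := div_pos (by linarith) (hlpos y hys)
          have h2 : 0 < -σ * h y := by
            have := hright x hx y hy hsx hys
            rcases hσ with rfl | rfl <;> nlinarith
          rw [← mul_assoc]; exact mul_pos h2 h1
    · push Not at hx
      refine ⟨l, σ, hl, fun t ht => Finset.mem_insert_of_mem (hlS t ht), hσ, fun y hy => ?_⟩
      rcases hcase y hy with hys | hys
      · exact hpos y ⟨hy, hys⟩
      · have h1 := hright y hy y hy hys hys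
        have h2 : 0 < σ * h y := by
          refine lt_of_le_of_ne (hx y hy hys) fun h0 => ?_
          rcases hσ with rfl | rfl <;> nlinarith
        rw [← mul_assoc]; exact mul_pos h2 (hlpos y hys)

/-! ### The half-disc -/

lemma isOpen_upperHalfDisc : IsOpen upperHalfDisc :=
  (isOpen_lt continuous_norm continuous_const).inter (isOpen_lt continuous_const Complex.continuous_im)

lemma convex_upperHalfDisc : Convex ℝ upperHalfDisc := by
  have : upperHalfDisc = Metric.ball 0 1 ∩ {z : ℂ | 0 < z.im} := by
    ext z; simp [upperHalfDisc]
  rw [this]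
  exact (convex_ball _ _).inter (convex_halfSpace_im_gt 0)

lemma isCompact_closure_upperHalfDisc : IsCompact (closure upperHalfDisc) := by
  refine (Metric.isBounded_ball (x := (0 : ℂ)) (r := 1)).subset ?_ |>.isCompact_closure
  intro z hz
  simpa using hz.1

lemma add_mul_I_mem_upperHalfDisc {z : ℂ} (hz : 0 ≤ z.im) {h : ℝ} (hh : 0 < h)
    (hzh : ‖z‖ + h < 1) : z + h * Complex.I ∈ upperHalfDisc := by
  refine ⟨lt_of_le_of_lt (norm_add_le _ _) ?_, ?_⟩
  · simpa [abs_of_pos hh] using hzh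
  · simp; linarith

lemma tendsto_add_mul_I (z : ℂ) :
    Filter.Tendsto (fun h : ℝ => z + h * Complex.I) (nhdsWithin 0 (Set.Ioi 0)) (nhds z) := by
  have : Continuous fun h : ℝ => z + h * Complex.I := by fun_prop
  simpa using (this.tendsto 0).mono_left nhdsWithin_le_nhds

lemma eventually_add_mul_I_mem {z : ℂ} (hz : ‖z‖ < 1) (hi : 0 ≤ z.im) :
    ∀ᶠ h : ℝ in nhdsWithin 0 (Set.Ioi 0), z + h * Complex.I ∈ upperHalfDisc := by
  have : Set.Ioo (0 : ℝ) (1 - ‖z‖) ∈ nhdsWithin (0 : ℝ) (Set.Ioi 0) :=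
    Ioo_mem_nhdsGT (by linarith)
  filter_upwards [this] with h hh
  exact add_mul_I_mem_upperHalfDisc hi hh.1 (by linarith [hh.2])

lemma mem_closure_upperHalfDisc {z : ℂ} (hz : ‖z‖ < 1) (hi : 0 ≤ z.im) :
    z ∈ closure upperHalfDisc :=
  mem_closure_of_tendsto (tendsto_add_mul_I z) (eventually_add_mul_I_mem hz hi)

lemma ofReal_mem_closure_upperHalfDisc {x : ℝ} (hx : |x| < 1) :
    (x : ℂ) ∈ closure upperHalfDisc :=
  mem_closure_upperHalfDisc (by simpa using hx) (by simp)

lemma norm_pos_of_mem {z : ℂ} (hz : z ∈ upperHalfDisc) : 0 < ‖z‖ := by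
  refine norm_pos_iff.2 fun h => ?_
  have := hz.2
  simp [h] at this

lemma ne_ofReal_of_mem {z : ℂ} (hz : z ∈ upperHalfDisc) (t : ℝ) : z ≠ t := fun h => by
  have := hz.2
  simp [h] at this

lemma norm_sub_ofReal_pos {z : ℂ} (hz : z ∈ upperHalfDisc) (t : ℝ) : 0 < ‖z - t‖ :=
  norm_pos_iff.2 (sub_ne_zero.2 (ne_ofReal_of_mem hz t))

lemma uniqueDiffOn_closure_upperHalfDisc : UniqueDiffOn ℝ (closure upperHalfDisc) := by
  refine uniqueDiffOn_convex convex_upperHalfDisc.closure ?_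
  refine ⟨Complex.I / 2, interior_mono subset_closure ?_⟩
  rw [isOpen_upperHalfDisc.interior_eq]
  constructor <;> norm_num

/-! ### Flatness at the origin -/

lemma exists_norm_le_of_contDiffOn (smooth : ContDiffOn ℝ ∞ f (closure upperHalfDisc)) :
    ∃ K : ℝ, 0 < K ∧ ∀ z ∈ closure upperHalfDisc, ‖f z‖ ≤ K := by
  obtain ⟨K, hK⟩ := isCompact_closure_upperHalfDisc.exists_bound_of_continuousOn smooth.continuousOn
  exact ⟨max K 1, by positivity, fun z hz => (hK z hz).trans (le_max_left _ _)⟩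

lemma exists_norm_le_pow (smooth : ContDiffOn ℝ ∞ f (closure upperHalfDisc))
    (flat : VanishesToInfiniteOrder f upperHalfDisc 0) (N : ℕ) :
    ∃ C : ℝ, 0 < C ∧ ∀ z ∈ upperHalfDisc, ‖f z‖ ≤ C * ‖z‖ ^ N := by
  obtain ⟨K, hK, hfK⟩ := exists_norm_le_of_contDiffOn smooth
  have h1 := (flat N).eventually (Metric.ball_mem_nhds 0 one_pos)
  rw [eventually_nhdsWithin_iff, Metric.eventually_nhds_iff] at h1
  obtain ⟨η, hη, h1⟩ := h1
  refine ⟨max 1 (K / η ^ N), by positivity, fun z hz => ?_⟩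
  have hz0 := norm_pos_of_mem hz
  by_cases hzη : ‖z‖ < η
  · have := h1 (by simpa using hzη) hz
    simp only [sub_zero, dist_zero_right, norm_div, Complex.norm_real, norm_pow, norm_norm] at this
    rw [div_lt_one (by positivity)] at this
    exact this.le.trans (le_mul_of_one_le_left (by positivity) (le_max_left _ _))
  · rw [not_lt] at hzη
    refine (hfK z (subset_closure hz)).trans ?_
    calc K = K / η ^ N * η ^ N := by field_simp
      _ ≤ max 1 (K / η ^ N) * ‖z‖ ^ N := by gcongr; exact le_max_right _ _

lemma exists_lipschitz_deriv (hol : DifferentiableOn ℂ f upperHalfDisc)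
    (smooth : ContDiffOn ℝ ∞ f (closure upperHalfDisc)) :
    ∃ L : ℝ, 0 < L ∧ ∀ z ∈ upperHalfDisc, ∀ w ∈ upperHalfDisc,
      ‖deriv f z - deriv f w‖ ≤ L * ‖z - w‖ := by
  have h1 : ContDiffOn ℝ 1 (fderivWithin ℝ f (closure upperHalfDisc)) (closure upperHalfDisc) :=
    smooth.fderivWithin uniqueDiffOn_closure_upperHalfDisc (by norm_cast)
  obtain ⟨L, hL⟩ := h1.exists_lipschitzOnWith one_ne_zero convex_upperHalfDisc.closure
    isCompact_closure_upperHalfDisc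
  have key : ∀ z ∈ upperHalfDisc, deriv f z = fderivWithin ℝ f (closure upperHalfDisc) z 1 := by
    intro z hz
    have hd : DifferentiableAt ℂ f z := hol.differentiableAt (isOpen_upperHalfDisc.mem_nhds hz)
    rw [fderivWithin_of_mem_nhds (Filter.mem_of_superset (isOpen_upperHalfDisc.mem_nhds hz)
      subset_closure), hd.fderiv_restrictScalars ℝ]
    simp
  refine ⟨L + 1, by positivity, fun z hz w hw => ?_⟩
  rw [key z hz, key w hw, ← sub_apply]
  refine (ContinuousLinearMap.le_opNorm _ _).trans ?_
  rw [norm_one, mul_one]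
  refine (hL.norm_sub_le (subset_closure hz) (subset_closure hw)).trans ?_
  gcongr
  linarith

/-- Flatness passes to the derivative: as `f'` is Lipschitz, a difference quotient of `f` with
step `‖z‖ ^ (N + 1) / 2` approximates it up to an error of the order of the step. -/
lemma exists_norm_deriv_le_pow (hol : DifferentiableOn ℂ f upperHalfDisc)
    (smooth : ContDiffOn ℝ ∞ f (closure upperHalfDisc))
    (flat : VanishesToInfiniteOrder f upperHalfDisc 0) (N : ℕ) :
    ∃ C : ℝ, 0 < C ∧ ∀ z ∈ upperHalfDisc, ‖deriv f z‖ ≤ C * ‖z‖ ^ N := by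
  obtain ⟨L, hL, hLip⟩ := exists_lipschitz_deriv hol smooth
  obtain ⟨C, hC, hfC⟩ := exists_norm_le_pow smooth flat (2 * (N + 1))
  have small : ∀ z ∈ upperHalfDisc, ‖z‖ ≤ 1 / 2 →
      ‖deriv f z‖ ≤ (2 * C * (2 ^ (2 * (N + 1)) + 1) + L) * ‖z‖ ^ N := by
    intro z hz hz2
    have hz0 := norm_pos_of_mem hz
    set h : ℝ := ‖z‖ ^ (N + 1) / 2 with hh
    have hh0 : 0 < h := by positivity
    have hhz : h ≤ ‖z‖ := by
      have : ‖z‖ ^ (N + 1) ≤ ‖z‖ := pow_le_of_le_one hz0.le (by linarith) (by simp)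
      linarith
    have hh4 : h ≤ 1 / 4 := by
      have : ‖z‖ ^ (N + 1) ≤ ‖z‖ := pow_le_of_le_one hz0.le (by linarith) (by simp)
      linarith
    have hw : z + h * Complex.I ∈ upperHalfDisc :=
      add_mul_I_mem_upperHalfDisc hz.2.le hh0 (by linarith)
    have hnorm : ‖z + h * Complex.I - z‖ = h := by simp [abs_of_pos hh0]
    have hmv : ‖(f (z + h * Complex.I) - deriv f z * (z + h * Complex.I)) -
        (f z - deriv f z * z)‖ ≤ L * h * ‖z + h * Complex.I - z‖ := by
      refine Convex.norm_image_sub_le_of_norm_hasDerivWithin_le (𝕜 := ℂ)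
        (f := fun w => f w - deriv f z * w) (f' := fun w => deriv f w - deriv f z)
        (s := upperHalfDisc ∩ Metric.closedBall z h) ?_ ?_
        (convex_upperHalfDisc.inter (convex_closedBall _ _)) ⟨hz, by simp [hh0.le]⟩
        ⟨hw, by rw [mem_closedBall_iff_norm, hnorm]⟩
      · intro w hw
        have hd := (hol.differentiableAt (isOpen_upperHalfDisc.mem_nhds hw.1)).hasDerivAt
        exact (hd.sub (by simpa using (hasDerivAt_id w).const_mul (deriv f z))).hasDerivWithinAt
      · intro w hw
        refine (hLip w hw.1 z hz).trans ?_
        gcongr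
        exact mem_closedBall_iff_norm.1 hw.2
    rw [hnorm] at hmv
    have hder : ‖deriv f z‖ * h ≤ C * (2 ^ (2 * (N + 1)) + 1) * ‖z‖ ^ (2 * (N + 1)) + L * h * h := by
      have e1 : ‖deriv f z‖ * h = ‖deriv f z * (h * Complex.I)‖ := by simp [abs_of_pos hh0]
      have e2 : deriv f z * (h * Complex.I) = f (z + h * Complex.I) - f z -
          ((f (z + h * Complex.I) - deriv f z * (z + h * Complex.I)) - (f z - deriv f z * z)) := by
        ring
      have e3 : ‖f (z + h * Complex.I)‖ ≤ C * (2 * ‖z‖) ^ (2 * (N + 1)) := by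
        refine (hfC _ hw).trans ?_
        gcongr
        refine (norm_add_le _ _).trans ?_
        simp only [norm_mul, Complex.norm_real, Complex.norm_I, mul_one, Real.norm_eq_abs,
          abs_of_pos hh0]
        linarith
      have e4 := hfC z hz
      rw [mul_pow] at e3
      rw [e1, e2]
      refine (norm_sub_le _ _).trans ?_
      have := norm_sub_le (f (z + h * Complex.I)) (f z)
      linarith
    have hpow : ‖z‖ ^ (2 * (N + 1)) = 2 * ‖z‖ ^ (N + 1) * h := by rw [hh]; ring
    rw [hpow] at hder
    have h5 : ‖deriv f z‖ ≤ 2 * C * (2 ^ (2 * (N + 1)) + 1) * ‖z‖ ^ (N + 1) + L * h := by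
      refine le_of_mul_le_mul_right (hder.trans_eq ?_) hh0
      ring
    have h6 : ‖z‖ ^ (N + 1) ≤ ‖z‖ ^ N :=
      pow_le_pow_of_le_one hz0.le (by linarith) (Nat.le_succ _)
    have h7 : h ≤ ‖z‖ ^ N := by
      have : 0 ≤ ‖z‖ ^ (N + 1) := by positivity
      linarith
    refine h5.trans ?_
    rw [add_mul]
    gcongr
  have hI : Complex.I / 4 ∈ upperHalfDisc := by constructor <;> norm_num
  refine ⟨(2 * C * (2 ^ (2 * (N + 1)) + 1) + L) + (‖deriv f (Complex.I / 4)‖ + 2 * L) * 2 ^ N,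
    by positivity, fun z hz => ?_⟩
  by_cases hz2 : ‖z‖ ≤ 1 / 2
  · refine (small z hz hz2).trans (mul_le_mul_of_nonneg_right ?_ (by positivity))
    exact le_add_of_nonneg_right (by positivity)
  · rw [not_le] at hz2
    have h1 : ‖deriv f z‖ ≤ ‖deriv f (Complex.I / 4)‖ + 2 * L := by
      have h2 := hLip z hz _ hI
      have h3 : ‖z - Complex.I / 4‖ ≤ 2 := (norm_sub_le _ _).trans (by
        have := hz.1
        have := hI.1
        linarith)
      have h4 := norm_add_le (deriv f z - deriv f (Complex.I / 4)) (deriv f (Complex.I / 4))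
      rw [sub_add_cancel] at h4
      nlinarith
    have h2 : 1 ≤ 2 ^ N * ‖z‖ ^ N := by
      rw [← mul_pow]; exact one_le_pow₀ (by linarith)
    calc ‖deriv f z‖ ≤ ‖deriv f (Complex.I / 4)‖ + 2 * L := h1
      _ ≤ (‖deriv f (Complex.I / 4)‖ + 2 * L) * (2 ^ N * ‖z‖ ^ N) :=
        le_mul_of_one_le_right (by positivity) h2
      _ ≤ _ := by
        rw [← mul_assoc]
        gcongr
        exact le_add_of_nonneg_left (by positivity)

/-- Near a boundary zero `t`, a linear factor can be divided out of `f` without losing flatness,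
uniformly in `t`. -/
lemma exists_norm_le_norm_sub_mul_pow (hol : DifferentiableOn ℂ f upperHalfDisc)
    (smooth : ContDiffOn ℝ ∞ f (closure upperHalfDisc))
    (flat : VanishesToInfiniteOrder f upperHalfDisc 0) (N : ℕ) :
    ∃ C : ℝ, 0 < C ∧ ∀ z ∈ upperHalfDisc, ∀ t : ℝ, |t| < 1 → f t = 0 →
      ‖f z‖ ≤ C * ‖z - t‖ * max ‖z‖ |t| ^ N := by
  obtain ⟨C, hC, hfC⟩ := exists_norm_deriv_le_pow hol smooth flat N
  refine ⟨C, hC, fun z hz t ht hft => ?_⟩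
  set R := max ‖z‖ |t| with hR
  have hz0 := norm_pos_of_mem hz
  have hR0 : 0 < R := lt_max_of_lt_left hz0
  have key : ∀ η : ℝ, η ∈ Set.Ioo (0 : ℝ) 1 →
      (t : ℂ) + η * (z - t) ∈ upperHalfDisc ∧
      ‖f z - f (t + η * (z - t))‖ ≤ C * ‖z - t‖ * R ^ N := by
    intro η hη
    have hnorm : ‖(t : ℂ) + η * (z - t)‖ ≤ R := by
      have e : (t : ℂ) + η * (z - t) = ((1 - η : ℝ) : ℂ) * t + (η : ℂ) * z := by push_cast; ring
      rw [e]
      refine (norm_add_le _ _).trans ?_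
      rw [norm_mul, norm_mul, Complex.norm_real, Complex.norm_real, Complex.norm_real,
        Real.norm_eq_abs, Real.norm_eq_abs, Real.norm_eq_abs, abs_of_pos hη.1,
        abs_of_pos (by linarith [hη.2] : 0 < 1 - η)]
      have h1 : ‖z‖ ≤ R := le_max_left _ _
      have h2 : |t| ≤ R := le_max_right _ _
      nlinarith [hη.1, hη.2]
    have hmem : (t : ℂ) + η * (z - t) ∈ upperHalfDisc := by
      refine ⟨hnorm.trans_lt (max_lt hz.1 ht), ?_⟩
      simpa using mul_pos hη.1 hz.2
    refine ⟨hmem, ?_⟩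
    have := Convex.norm_image_sub_le_of_norm_hasDerivWithin_le (𝕜 := ℂ) (f := f) (f' := deriv f)
      (s := upperHalfDisc ∩ Metric.closedBall 0 R) (C := C * R ^ N)
      (fun w hw => (hol.differentiableAt
        (isOpen_upperHalfDisc.mem_nhds hw.1)).hasDerivAt.hasDerivWithinAt)
      (fun w hw => (hfC w hw.1).trans <| by
        have := hw.2
        rw [mem_closedBall_zero_iff] at this
        gcongr)
      (convex_upperHalfDisc.inter (convex_closedBall _ _))
      ⟨hmem, by simpa using hnorm⟩ ⟨hz, by simp [hR]⟩
    refine this.trans ?_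
    have e : z - (t + η * (z - t)) = ((1 - η : ℝ) : ℂ) * (z - t) := by push_cast; ring
    rw [e, norm_mul, Complex.norm_real, Real.norm_eq_abs,
      abs_of_pos (by linarith [hη.2] : 0 < 1 - η)]
    have h3 : (1 - η) * ‖z - t‖ ≤ ‖z - t‖ :=
      mul_le_of_le_one_left (norm_nonneg _) (by linarith [hη.1])
    calc C * R ^ N * ((1 - η) * ‖z - t‖) ≤ C * R ^ N * ‖z - t‖ := by gcongr
      _ = _ := by ring
  have hev : ∀ᶠ η : ℝ in nhdsWithin 0 (Set.Ioi 0), η ∈ Set.Ioo (0 : ℝ) 1 :=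
    Ioo_mem_nhdsGT one_pos
  have hlim : Filter.Tendsto (fun η : ℝ => f (t + η * (z - t))) (nhdsWithin 0 (Set.Ioi 0))
      (nhds 0) := by
    rw [← hft]
    refine (smooth.continuousOn _ (ofReal_mem_closure_upperHalfDisc ht)).tendsto.comp
      (tendsto_nhdsWithin_iff.2 ⟨?_, ?_⟩)
    · have : Continuous fun η : ℝ => (t : ℂ) + η * (z - t) := by fun_prop
      simpa using (this.tendsto 0).mono_left nhdsWithin_le_nhds
    · filter_upwards [hev] with η hη
      exact subset_closure (key η hη).1
  have hlim2 : Filter.Tendsto (fun η : ℝ => ‖f z - f (t + η * (z - t))‖)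
      (nhdsWithin 0 (Set.Ioi 0)) (nhds ‖f z‖) := by
    simpa using (hlim.const_sub (f z)).norm
  exact le_of_tendsto hlim2 (hev.mono fun η hη => (key η hη).2)

lemma norm_sub_ofReal_div_two_le_one {z : ℂ} (hz : ‖z‖ ≤ 1) {t : ℝ} (ht : |t| < 1) :
    ‖z - t‖ / 2 ≤ 1 := by
  have := norm_sub_le z t
  rw [Complex.norm_real, Real.norm_eq_abs] at this
  linarith

/-- The product of `f` with the alternating quotient over any set of its boundary zeros is flat at
the origin, with constants that do not depend on the set: the quotient is at most `2 / ‖z - t‖` for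
the nearest point `t` of the set, and `f` vanishes there. -/
lemma exists_norm_mul_nodeQuotient_le_pow (hol : DifferentiableOn ℂ f upperHalfDisc)
    (smooth : ContDiffOn ℝ ∞ f (closure upperHalfDisc))
    (flat : VanishesToInfiniteOrder f upperHalfDisc 0) (N : ℕ) :
    ∃ C : ℝ, 0 < C ∧ ∀ l : List ℝ, l.Pairwise (· > ·) → (∀ t ∈ l, |t| < 1 ∧ f t = 0) →
      ∀ z ∈ upperHalfDisc, ‖f z * nodeQuotient l z‖ ≤ C * ‖z‖ ^ N := by
  obtain ⟨C, hC, hfC⟩ := exists_norm_le_norm_sub_mul_pow hol smooth flat N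
  obtain ⟨C', hC', hfC'⟩ := exists_norm_le_pow smooth flat (N + 1)
  refine ⟨2 * C * 2 ^ N + 2 * C', by positivity, fun l hl hlt z hz => ?_⟩
  have hz0 := norm_pos_of_mem hz
  have hle : ∀ t ∈ l, ‖z - t‖ / 2 ≤ 1 := fun t ht =>
    norm_sub_ofReal_div_two_le_one hz.1.le (hlt t ht).1
  rw [norm_mul]
  by_cases hnear : ∀ t ∈ l, ‖z‖ ≤ ‖z - t‖
  · have h1 := (norm_nodeQuotient_mem_Icc (m := ‖z‖ / 2) (by positivity) (by linarith [hz.1]) l hl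
      (fun t ht => by linarith [hnear t ht]) hle).2
    calc ‖f z‖ * ‖nodeQuotient l z‖ ≤ (C' * ‖z‖ ^ (N + 1)) * (1 / (‖z‖ / 2)) := by
          gcongr; exact hfC' z hz
      _ = 2 * C' * ‖z‖ ^ N := by rw [pow_succ]; field_simp
      _ ≤ _ := by gcongr; exact le_add_of_nonneg_left (by positivity)
  · push Not at hnear
    obtain ⟨s, hs, hsz⟩ := hnear
    obtain ⟨t, ht, hmin⟩ := l.toFinset.exists_min_image (fun t : ℝ => ‖z - t‖) ⟨s, by simpa using hs⟩
    simp only [List.mem_toFinset] at ht hmin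
    have htz : ‖z - t‖ < ‖z‖ := (hmin s hs).trans_lt hsz
    have hpos := norm_sub_ofReal_pos hz t
    have h1 := (norm_nodeQuotient_mem_Icc (m := ‖z - t‖ / 2) (by positivity) (hle t ht) l hl
      (fun s hs => by linarith [hmin s hs]) hle).2
    have h2 : max ‖z‖ |t| ≤ 2 * ‖z‖ := by
      refine max_le (by linarith) ?_
      have := norm_sub_norm_le (t : ℂ) z
      rw [norm_sub_rev, Complex.norm_real, Real.norm_eq_abs] at this
      linarith
    calc ‖f z‖ * ‖nodeQuotient l z‖
        ≤ (C * ‖z - t‖ * (2 * ‖z‖) ^ N) * (1 / (‖z - t‖ / 2)) := by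
          gcongr
          refine (hfC z hz t (hlt t ht).1 (hlt t ht).2).trans ?_
          gcongr
      _ = 2 * C * 2 ^ N * ‖z‖ ^ N := by rw [mul_pow]; field_simp
      _ ≤ _ := by gcongr; exact le_add_of_nonneg_right (by positivity)

/-! ### The moment estimate -/

/-- The integrand `(1/4 - z²) f(z) M(z) / z^N`, where `M` is the alternating quotient over `l`. The
weight `1/4 - z²` is positive on `(-1/2, 1/2)`, and on the vertical lines through `±1/2` it offsets
the growth of `M` at the real axis. -/
noncomputable def momentIntegrand (f : ℂ → ℂ) (l : List ℝ) (N : ℕ) (z : ℂ) : ℂ :=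
  (1 / 4 - z ^ 2) * (f z * nodeQuotient l z) / z ^ N

lemma differentiableOn_momentIntegrand (hol : DifferentiableOn ℂ f upperHalfDisc) (l : List ℝ)
    (N : ℕ) : DifferentiableOn ℂ (momentIntegrand f l N) upperHalfDisc := by
  intro z hz
  have h1 : DifferentiableAt ℂ f z := hol.differentiableAt (isOpen_upperHalfDisc.mem_nhds hz)
  have h2 : DifferentiableAt ℂ (nodeQuotient l) z :=
    differentiableAt_nodeQuotient fun t _ => ne_ofReal_of_mem hz t
  have h3 : DifferentiableAt ℂ (fun z : ℂ => 1 / 4 - z ^ 2) z := by fun_prop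
  exact ((h3.mul (h1.mul h2)).div (differentiableAt_id.pow N)
    (pow_ne_zero _ (norm_pos_iff.1 (norm_pos_of_mem hz)))).differentiableWithinAt

lemma norm_nodeQuotient_le_im {l : List ℝ} (hl : l.Pairwise (· > ·)) (hlt : ∀ t ∈ l, |t| < 1)
    {z : ℂ} (hz : z ∈ upperHalfDisc) : ‖nodeQuotient l z‖ ≤ 2 / z.im := by
  have him : 0 < z.im := hz.2
  have h1 : z.im ≤ ‖z‖ := (le_abs_self _).trans (Complex.abs_im_le_norm z)
  have := (norm_nodeQuotient_mem_Icc (z := z) (m := z.im / 2) (by positivity)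
    (by linarith [hz.1]) l hl (fun t _ => ?_)
    (fun t ht => norm_sub_ofReal_div_two_le_one hz.1.le (hlt t ht))).2
  · rwa [one_div_div] at this
  · have h2 := (le_abs_self _).trans (Complex.abs_im_le_norm (z - t))
    rw [Complex.sub_im, Complex.ofReal_im, sub_zero] at h2
    linarith

lemma add_mul_I_mem_of_abs_le_half {x y : ℝ} (hx : |x| ≤ 1 / 2) (hy : 0 < y) (hy2 : y ≤ 1 / 2) :
    (x : ℂ) + y * Complex.I ∈ upperHalfDisc := by
  refine ⟨?_, by simpa using hy⟩
  rw [← sq_lt_one_iff₀ (norm_nonneg _), Complex.sq_norm, Complex.normSq_apply]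
  have := abs_le.1 hx
  simp
  nlinarith

lemma norm_momentIntegrand_le {l : List ℝ} {N : ℕ} {z : ℂ} {K B : ℝ} (hK : ‖f z‖ ≤ K)
    (hB : ‖(1 / 4 - z ^ 2 : ℂ)‖ * ‖nodeQuotient l z‖ ≤ B) (hz : 1 / 2 ≤ ‖z‖) (hK0 : 0 ≤ K)
    (hB0 : 0 ≤ B) : ‖momentIntegrand f l N z‖ ≤ K * B * 2 ^ N := by
  have h1 : (1 / 2 : ℝ) ^ N ≤ ‖z‖ ^ N := by gcongr
  rw [momentIntegrand, norm_div, norm_mul, norm_mul, norm_pow]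
  calc ‖(1 / 4 - z ^ 2 : ℂ)‖ * (‖f z‖ * ‖nodeQuotient l z‖) / ‖z‖ ^ N
      = ‖f z‖ * (‖(1 / 4 - z ^ 2 : ℂ)‖ * ‖nodeQuotient l z‖) / ‖z‖ ^ N := by ring
    _ ≤ K * B / (1 / 2 : ℝ) ^ N := by gcongr
    _ = K * B * 2 ^ N := by rw [one_div, inv_pow, div_inv_eq_mul]

lemma half_le_norm_of_re {z : ℂ} (h : |z.re| = 1 / 2) : 1 / 2 ≤ ‖z‖ :=
  h ▸ Complex.abs_re_le_norm z

lemma norm_weight_side {x y : ℝ} (hx : |x| = 1 / 2) (hy : 0 < y) (hy2 : y ≤ 1 / 2) :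
    ‖(1 / 4 - ((x : ℂ) + y * Complex.I) ^ 2 : ℂ)‖ ≤ 2 * y := by
  have hx2 : x ^ 2 = 1 / 4 := by rw [← sq_abs, hx]; norm_num
  have e : (1 / 4 - ((x : ℂ) + y * Complex.I) ^ 2 : ℂ) = y * (y - 2 * x * Complex.I) := by
    have : (x : ℂ) ^ 2 = 1 / 4 := by simpa using congrArg Complex.ofReal hx2
    linear_combination (-1 : ℂ) * this - (y : ℂ) ^ 2 * Complex.I_sq
  rw [e, norm_mul, Complex.norm_real, Real.norm_eq_abs, abs_of_pos hy, mul_comm]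
  gcongr
  refine (norm_sub_le _ _).trans ?_
  simp only [Complex.norm_real, Real.norm_eq_abs, norm_mul, Complex.norm_I, hx, abs_of_pos hy]
  norm_num
  linarith

/-- By Cauchy's theorem on the rectangle `[-1/2, 1/2] × [ε, 1/2]`, the integral over the bottom side
equals that over the three others, where `‖z‖ ≥ 1/2`. -/
lemma exists_norm_integral_momentIntegrand_le (hol : DifferentiableOn ℂ f upperHalfDisc)
    (smooth : ContDiffOn ℝ ∞ f (closure upperHalfDisc)) :
    ∃ A : ℝ, 0 < A ∧ ∀ (l : List ℝ) (N : ℕ), l.Pairwise (· > ·) → (∀ t ∈ l, |t| < 1) →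
      ∀ ε : ℝ, 0 < ε → ε ≤ 1 / 2 →
      ‖∫ x : ℝ in (-1 / 2)..(1 / 2), momentIntegrand f l N (x + ε * Complex.I)‖ ≤ A * 2 ^ N := by
  obtain ⟨K, hK, hfK⟩ := exists_norm_le_of_contDiffOn smooth
  refine ⟨K * 4 + (K * 4 + K * 4), by positivity, fun l N hl hlt ε hε hε2 => ?_⟩
  have hrect := Complex.integral_boundary_rect_eq_zero_of_differentiableOn
    (momentIntegrand f l N) ⟨-1 / 2, ε⟩ ⟨1 / 2, 1 / 2⟩
    ((differentiableOn_momentIntegrand hol l N).mono fun z hz => by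
      rw [Complex.mem_reProdIm, Set.uIcc_of_le (by norm_num), Set.uIcc_of_le hε2] at hz
      rw [← Complex.re_add_im z]
      exact add_mul_I_mem_of_abs_le_half (abs_le.2 ⟨by linarith [hz.1.1], hz.1.2⟩)
        (hε.trans_le hz.2.1) hz.2.2)
  simp only at hrect
  have htop : ‖∫ x : ℝ in (-1 / 2)..(1 / 2),
      momentIntegrand f l N (x + ((1 / 2 : ℝ) : ℂ) * Complex.I)‖ ≤ K * 4 * 2 ^ N := by
    refine (intervalIntegral.norm_integral_le_of_norm_le_const (C := K * 4 * 2 ^ N)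
      fun x hx => ?_).trans_eq (by norm_num)
    rw [Set.uIoc_of_le (by norm_num)] at hx
    have hz := add_mul_I_mem_of_abs_le_half (x := x) (y := 1 / 2)
      (abs_le.2 ⟨by linarith [hx.1], hx.2⟩) (by norm_num) le_rfl
    set z : ℂ := x + ((1 / 2 : ℝ) : ℂ) * Complex.I
    have him : z.im = 1 / 2 := by simp [z]
    have h1 := norm_nodeQuotient_le_im hl hlt hz
    rw [him] at h1
    have h2 : ‖z‖ ^ 2 ≤ 1 / 2 := by
      have := abs_le.1 (abs_le.2 ⟨by linarith [hx.1], hx.2⟩ : |x| ≤ 1 / 2)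
      rw [Complex.sq_norm, Complex.normSq_apply, him]
      simp [z]
      nlinarith
    have h3 : ‖(1 / 4 - z ^ 2 : ℂ)‖ ≤ 1 := by
      refine (norm_sub_le _ _).trans ?_
      rw [norm_pow]
      norm_num
      linarith
    refine norm_momentIntegrand_le (hfK z (subset_closure hz)) ?_ ?_ hK.le (by norm_num)
    · calc _ ≤ 1 * (2 / (1 / 2) : ℝ) := by gcongr
        _ = 4 := by norm_num
    · exact him ▸ (le_abs_self _).trans (Complex.abs_im_le_norm z)
  have hside : ∀ x : ℝ, |x| = 1 / 2 → ‖Complex.I • ∫ y : ℝ in ε..(1 / 2),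
      momentIntegrand f l N (x + y * Complex.I)‖ ≤ K * 4 * 2 ^ N := by
    intro x hx
    rw [norm_smul, Complex.norm_I, one_mul]
    refine (intervalIntegral.norm_integral_le_of_norm_le_const (C := K * 4 * 2 ^ N)
      fun y hy => ?_).trans ?_
    · rw [Set.uIoc_of_le hε2] at hy
      have hy0 : 0 < y := hε.trans hy.1
      have hz := add_mul_I_mem_of_abs_le_half hx.le hy0 hy.2
      have h1 := norm_nodeQuotient_le_im hl hlt hz
      have h2 := norm_weight_side hx hy0 hy.2
      have him : ((x : ℂ) + y * Complex.I).im = y := by simp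
      rw [him] at h1
      refine norm_momentIntegrand_le (hfK _ (subset_closure hz)) ?_
        (half_le_norm_of_re (by simpa using hx)) hK.le (by norm_num)
      calc _ ≤ 2 * y * (2 / y) := by gcongr
        _ = 4 := by field_simp; norm_num
    · refine mul_le_of_le_one_right (by positivity) ?_
      exact abs_le.2 ⟨by linarith, by linarith⟩
  have hr := hside (1 / 2) (by norm_num)
  have hl' := hside (-1 / 2) (by norm_num [abs_of_neg])
  have e : (∫ x : ℝ in (-1 / 2)..(1 / 2), momentIntegrand f l N (x + ε * Complex.I)) =
      (∫ x : ℝ in (-1 / 2)..(1 / 2), momentIntegrand f l N (x + ((1 / 2 : ℝ) : ℂ) * Complex.I)) -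
      (Complex.I • ∫ y : ℝ in ε..(1 / 2),
        momentIntegrand f l N (((1 / 2 : ℝ) : ℂ) + y * Complex.I)) +
      (Complex.I • ∫ y : ℝ in ε..(1 / 2),
        momentIntegrand f l N (((-1 / 2 : ℝ) : ℂ) + y * Complex.I)) := by
    linear_combination hrect
  rw [e]
  refine (norm_add_le _ _).trans ?_
  have := norm_sub_le
    (∫ x : ℝ in (-1 / 2)..(1 / 2), momentIntegrand f l N (x + ((1 / 2 : ℝ) : ℂ) * Complex.I))
    (Complex.I • ∫ y : ℝ in ε..(1 / 2),
        momentIntegrand f l N (((1 / 2 : ℝ) : ℂ) + y * Complex.I))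
  linarith

lemma tendsto_momentIntegrand (smooth : ContDiffOn ℝ ∞ f (closure upperHalfDisc)) {l : List ℝ}
    (N : ℕ) {x : ℝ} (hx : |x| < 1) (hx0 : x ≠ 0) (hxl : x ∉ l) :
    Filter.Tendsto (fun ε : ℝ => momentIntegrand f l N (x + ε * Complex.I))
      (nhdsWithin 0 (Set.Ioi 0)) (nhds (momentIntegrand f l N x)) := by
  have hlim := tendsto_add_mul_I (x : ℂ)
  have hf : Filter.Tendsto (fun ε : ℝ => f (x + ε * Complex.I))
      (nhdsWithin 0 (Set.Ioi 0)) (nhds (f x)) :=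
    (smooth.continuousOn _ (ofReal_mem_closure_upperHalfDisc hx)).tendsto.comp
      (tendsto_nhdsWithin_iff.2 ⟨hlim, (eventually_add_mul_I_mem (by simpa using hx)
        (by simp)).mono fun _ h => subset_closure h⟩)
  have hM : Filter.Tendsto (fun ε : ℝ => nodeQuotient l (x + ε * Complex.I))
      (nhdsWithin 0 (Set.Ioi 0)) (nhds (nodeQuotient l x)) :=
    (differentiableAt_nodeQuotient fun t ht h => hxl <| by
      rwa [Complex.ofReal_injective h]).continuousAt.tendsto.comp hlim
  exact ((tendsto_const_nhds.sub (hlim.pow 2)).mul (hf.mul hM)).div (hlim.pow N)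
    (pow_ne_zero _ (by exact_mod_cast hx0))

/-- Boundary form of the estimates: on the real axis the integrand is bounded independently of the
zeros divided out, and its integral grows at most like `2 ^ N`. -/
lemma exists_moment_bounds (hol : DifferentiableOn ℂ f upperHalfDisc)
    (smooth : ContDiffOn ℝ ∞ f (closure upperHalfDisc))
    (flat : VanishesToInfiniteOrder f upperHalfDisc 0) :
    ∃ A : ℝ, 0 < A ∧ ∀ N : ℕ, ∃ C : ℝ, 0 < C ∧ ∀ l : List ℝ, l.Pairwise (· > ·) →
      (∀ t ∈ l, |t| < 1 ∧ f t = 0) →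
      (∀ x : ℝ, |x| ≤ 1 / 2 → x ≠ 0 → x ∉ l → ‖momentIntegrand f l N x‖ ≤ C) ∧
      IntervalIntegrable (fun x : ℝ => momentIntegrand f l N x) MeasureTheory.volume
        (-1 / 2) (1 / 2) ∧
      ‖∫ x : ℝ in (-1 / 2)..(1 / 2), momentIntegrand f l N x‖ ≤ A * 2 ^ N := by
  obtain ⟨A, hA, hint⟩ := exists_norm_integral_momentIntegrand_le hol smooth
  refine ⟨A, hA, fun N => ?_⟩
  obtain ⟨C, hC, hfC⟩ := exists_norm_mul_nodeQuotient_le_pow hol smooth flat N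
  refine ⟨2 * C, by positivity, fun l hl hlt => ?_⟩
  have hbd : ∀ z ∈ upperHalfDisc, ‖momentIntegrand f l N z‖ ≤ 2 * C := by
    intro z hz
    have hz0 := norm_pos_of_mem hz
    have h1 : ‖(1 / 4 - z ^ 2 : ℂ)‖ ≤ 2 := by
      refine (norm_sub_le _ _).trans ?_
      have : ‖z‖ ^ 2 ≤ 1 := pow_le_one₀ hz0.le hz.1.le
      rw [norm_pow]
      norm_num
      linarith
    rw [momentIntegrand, norm_div, norm_mul, norm_pow, div_le_iff₀ (by positivity), mul_assoc]
    exact mul_le_mul h1 (hfC l hl hlt z hz) (norm_nonneg _) (by norm_num)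
  have hev : ∀ᶠ ε : ℝ in nhdsWithin 0 (Set.Ioi 0), ε ∈ Set.Ioo (0 : ℝ) (1 / 2) :=
    Ioo_mem_nhdsGT (by norm_num)
  have hpt : ∀ x : ℝ, |x| ≤ 1 / 2 → x ≠ 0 → x ∉ l → ‖momentIntegrand f l N x‖ ≤ 2 * C := by
    intro x hx hx0 hxl
    refine le_of_tendsto (tendsto_momentIntegrand smooth N (by linarith) hx0 hxl).norm ?_
    filter_upwards [hev] with ε hε
    exact hbd _ (add_mul_I_mem_of_abs_le_half hx hε.1 hε.2.le)
  have hfin : ∀ᵐ x : ℝ, x ≠ 0 ∧ x ∉ l := by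
    have : Set.Finite ({0} ∪ {x | x ∈ l} : Set ℝ) := (Set.finite_singleton 0).union l.finite_toSet
    filter_upwards [this.countable.ae_notMem MeasureTheory.volume] with x hx
    simpa using hx
  have habs : ∀ x ∈ Set.uIoc (-1 / 2 : ℝ) (1 / 2), |x| ≤ 1 / 2 := by
    intro x hx
    rw [Set.uIoc_of_le (by norm_num)] at hx
    exact abs_le.2 ⟨by linarith [hx.1], hx.2⟩
  have hmeas : ∀ ε ∈ Set.Ioo (0 : ℝ) (1 / 2), MeasureTheory.AEStronglyMeasurable
      (fun x : ℝ => momentIntegrand f l N (x + ε * Complex.I))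
      (MeasureTheory.volume.restrict (Set.uIoc (-1 / 2 : ℝ) (1 / 2))) := by
    intro ε hε
    refine ContinuousOn.aestronglyMeasurable ?_ measurableSet_uIoc
    refine (differentiableOn_momentIntegrand hol l N).continuousOn.comp (by fun_prop) ?_
    exact fun x hx => add_mul_I_mem_of_abs_le_half (habs x hx) hε.1 hε.2.le
  have hlim : ∀ᵐ x : ℝ, x ∈ Set.uIoc (-1 / 2 : ℝ) (1 / 2) →
      Filter.Tendsto (fun ε : ℝ => momentIntegrand f l N (x + ε * Complex.I))
        (nhdsWithin 0 (Set.Ioi 0)) (nhds (momentIntegrand f l N x)) := by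
    filter_upwards [hfin] with x hx hxI
    exact tendsto_momentIntegrand smooth N (by linarith [habs x hxI]) hx.1 hx.2
  refine ⟨hpt, ?_, ?_⟩
  · rw [intervalIntegrable_iff]
    have : MeasureTheory.IsFiniteMeasure
        (MeasureTheory.volume.restrict (Set.uIoc (-1 / 2 : ℝ) (1 / 2))) := ⟨by simp [Set.uIoc]⟩
    refine MeasureTheory.Integrable.of_bound ?_ (2 * C) ?_
    · refine aestronglyMeasurable_of_tendsto_ae (nhdsWithin (0 : ℝ) (Set.Ioi 0))
        (f := fun ε x => if ε ∈ Set.Ioo (0 : ℝ) (1 / 2) then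
          momentIntegrand f l N ((x : ℝ) + ε * Complex.I) else 0) (fun ε => ?_) ?_
      · by_cases hε : ε ∈ Set.Ioo (0 : ℝ) (1 / 2)
        · simpa only [hε, if_true] using hmeas ε hε
        · simpa only [hε, if_false] using MeasureTheory.aestronglyMeasurable_const
      · rw [MeasureTheory.ae_restrict_iff' measurableSet_uIoc]
        filter_upwards [hlim] with x hx hxI
        refine (hx hxI).congr' ?_
        filter_upwards [hev] with ε hε
        rw [if_pos hε]
    · rw [MeasureTheory.ae_restrict_iff' measurableSet_uIoc]
      filter_upwards [hfin] with x hx hxI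
      exact hpt x (habs x hxI) hx.1 hx.2
  · have := intervalIntegral.tendsto_integral_filter_of_dominated_convergence
      (l := nhdsWithin (0 : ℝ) (Set.Ioi 0)) (a := -1 / 2) (b := 1 / 2) (μ := MeasureTheory.volume)
      (F := fun ε (x : ℝ) => momentIntegrand f l N (x + ε * Complex.I))
      (f := fun x : ℝ => momentIntegrand f l N x) (fun _ => 2 * C)
      (hev.mono hmeas) ?_ (by simp) hlim
    · refine le_of_tendsto this.norm ?_
      filter_upwards [hev] with ε hε
      exact hint l N hl (fun t ht => (hlt t ht).1) ε hε.1 hε.2.le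
    · filter_upwards [hev] with ε hε
      exact Filter.Eventually.of_forall fun x hx =>
        hbd _ (add_mul_I_mem_of_abs_le_half (habs x hx) hε.1 hε.2.le)

/-! ### Vanishing on the real interval -/

lemma apply_zero_of_flat (smooth : ContDiffOn ℝ ∞ f (closure upperHalfDisc))
    (flat : VanishesToInfiniteOrder f upperHalfDisc 0) : f 0 = 0 := by
  have h0 : (0 : ℂ) ∈ closure upperHalfDisc := mem_closure_upperHalfDisc (by simp) (by simp)
  have h1 := flat 0
  simp only [pow_zero, Complex.ofReal_one, div_one] at h1
  have := mem_closure_iff_nhdsWithin_neBot.1 h0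
  exact tendsto_nhds_unique
    ((smooth.continuousOn 0 h0).tendsto.mono_left (nhdsWithin_mono _ subset_closure)) h1

lemma continuousOn_re_ofReal (smooth : ContDiffOn ℝ ∞ f (closure upperHalfDisc)) :
    ContinuousOn (fun x : ℝ => (f x).re) (Set.Ioo (-1) 1) :=
  Complex.continuous_re.comp_continuousOn <| smooth.continuousOn.comp
    Complex.continuous_ofReal.continuousOn
    fun _ hx => ofReal_mem_closure_upperHalfDisc (abs_lt.2 hx)

lemma finite_zeros_away_from_zero
    (zeros : ∀ x ∈ Set.Ioo (-1 : ℝ) 1, AccPt x (Filter.principal (realZeros f)) → x = 0)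
    {δ : ℝ} (hδ : 0 < δ) : {x : ℝ | |x| ≤ 1 / 2 ∧ δ ≤ |x| ∧ f x = 0}.Finite := by
  by_contra hinf
  have hK : IsCompact (Set.Icc (-1 / 2 : ℝ) (1 / 2) ∩ {x | δ ≤ |x|}) :=
    isCompact_Icc.inter_right (isClosed_le continuous_const continuous_abs)
  obtain ⟨x, hx, hacc⟩ := Set.Infinite.exists_accPt_of_subset_isCompact hinf hK
    fun x hx => ⟨⟨by linarith [(abs_le.1 hx.1).1], (abs_le.1 hx.1).2⟩, hx.2.1⟩
  have : x = 0 := by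
    refine zeros x ⟨by linarith [hx.1.1], by linarith [hx.1.2]⟩ (hacc.mono ?_)
    refine Filter.principal_mono.2 fun y hy => ⟨?_, hy.2.2⟩
    exact ⟨by linarith [(abs_le.1 hy.1).1], by linarith [(abs_le.1 hy.1).2]⟩
  have h2 : δ ≤ |x| := hx.2
  rw [this, abs_zero] at h2
  linarith

/-- Away from the origin, some alternating quotient over zeros of `f` has the sign of `Re f` up to
a global sign. The origin itself may be one of the points, if the signs on its two sides disagree. -/
lemma exists_nodeQuotient_sign_re (smooth : ContDiffOn ℝ ∞ f (closure upperHalfDisc))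
    (zeros : ∀ x ∈ Set.Ioo (-1 : ℝ) 1, AccPt x (Filter.principal (realZeros f)) → x = 0)
    (hf0 : f 0 = 0) (hre : ∀ x ∈ Set.Ioo (-1 : ℝ) 1, (f x).re = 0 → f x = 0)
    {δ : ℝ} (hδ : 0 < δ) :
    ∃ (l : List ℝ) (σ : ℝ), l.Pairwise (· > ·) ∧ (∀ t ∈ l, |t| < 1 ∧ f t = 0) ∧
      (σ = 1 ∨ σ = -1) ∧ ∀ x : ℝ, |x| ≤ 1 / 2 → δ ≤ |x| → f x ≠ 0 →
        0 < σ * ((f x).re * (nodeQuotient l x).re) := by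
  have hfin := finite_zeros_away_from_zero zeros hδ
  have hS : ∀ t : ℝ, t ∈ insert 0 hfin.toFinset ↔ t = 0 ∨ (|t| ≤ 1 / 2 ∧ δ ≤ |t| ∧ f t = 0) := by
    simp
  set D : Set ℝ := {x : ℝ | |x| ≤ 1 / 2 ∧ δ ≤ |x| ∧ f x ≠ 0}
  have hconst : ∀ x ∈ D, ∀ y ∈ D, x ≤ y → (∀ s ∈ insert 0 hfin.toFinset, s ∉ Set.Icc x y) →
      0 < (f x).re * (f y).re := by
    intro x hx y hy hxy hno
    by_contra hneg
    rw [not_lt] at hneg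
    have hx1 := abs_le.1 hx.1
    have hy1 := abs_le.1 hy.1
    have hsub : Set.uIcc x y ⊆ Set.Ioo (-1) 1 := by
      rw [Set.uIcc_of_le hxy]
      exact fun w hw => ⟨by linarith [hw.1], by linarith [hw.2]⟩
    have h0 : (0 : ℝ) ∈ Set.uIcc (f x).re (f y).re := by
      rw [Set.mem_uIcc]
      rcases mul_nonpos_iff.1 hneg with h | h
      · exact Or.inr ⟨h.2, h.1⟩
      · exact Or.inl h
    obtain ⟨w, hw, hw0⟩ := intermediate_value_uIcc ((continuousOn_re_ofReal smooth).mono hsub) h0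
    have hfw := hre w (hsub hw) hw0
    rw [Set.uIcc_of_le hxy] at hw
    have h00 : (0 : ℝ) ∉ Set.Icc x y := hno 0 ((hS 0).2 (Or.inl rfl))
    refine hno w ((hS w).2 (Or.inr ⟨?_, ?_, hfw⟩)) hw
    · exact abs_le.2 ⟨by linarith [hw.1], by linarith [hw.2]⟩
    · have hx2 := hx.2.1
      have hy2 := hy.2.1
      by_cases hx0 : 0 < x
      · rw [abs_of_pos hx0] at hx2
        rw [abs_of_pos (hx0.trans_le hw.1)]
        exact hx2.trans hw.1
      · have hy0 : y < 0 := by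
          by_contra hy0
          exact h00 ⟨not_lt.1 hx0, not_lt.1 hy0⟩
        rw [abs_of_neg hy0] at hy2
        rw [abs_of_neg (hw.2.trans_lt hy0)]
        linarith [hw.2]
  have hDS : ∀ x ∈ D, x ∉ insert 0 hfin.toFinset := by
    intro x hx hxS
    rcases (hS x).1 hxS with rfl | h
    · exact hx.2.2 (by simpa using hf0)
    · exact hx.2.2 h.2.2
  obtain ⟨l, σ, hl, hlS, hσ, hpos⟩ := exists_nodeQuotient_sign (insert 0 hfin.toFinset)
    D (fun x => (f x).re) hconst hDS
  refine ⟨l, σ, hl, fun t ht => ?_, hσ, fun x h1 h2 h3 => hpos x ⟨h1, h2, h3⟩⟩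
  rcases (hS t).1 (hlS t ht) with rfl | h
  · simp [hf0]
  · exact ⟨by linarith [h.1], h.2.2⟩

lemma re_momentIntegrand_ofReal (l : List ℝ) (N : ℕ) (x : ℝ) :
    (momentIntegrand f l N x).re =
      (1 / 4 - x ^ 2) / x ^ N * ((f x).re * (nodeQuotient l x).re) := by
  have h : nodeQuotient l x = ((nodeQuotient l x).re : ℂ) :=
    Complex.ext rfl (by simp [im_nodeQuotient_ofReal])
  have : momentIntegrand f l N x =
      (((1 / 4 - x ^ 2) / x ^ N * (nodeQuotient l x).re : ℝ) : ℂ) * f x := by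
    rw [momentIntegrand, h]
    push_cast
    simp only [Complex.ofReal_re]
    ring
  rw [this, Complex.re_ofReal_mul]
  ring

lemma integral_indicator_Icc {a b k : ℝ} (ha : -1 / 2 < a) (hab : a ≤ b) (hb : b ≤ 1 / 2) :
    ∫ x in (-1 / 2 : ℝ)..(1 / 2), (Set.Icc a b).indicator (fun _ => k) x = (b - a) * k := by
  rw [intervalIntegral.integral_of_le (by norm_num),
    MeasureTheory.setIntegral_indicator measurableSet_Icc,
    Set.inter_eq_self_of_subset_right (s := Set.Ioc (-1 / 2) (1 / 2)) (t := Set.Icc a b)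
      fun x hx => ⟨ha.trans_le hx.1, hx.2.trans hb⟩]
  simp [hab]

lemma intervalIntegrable_indicator_Icc (a b k : ℝ) :
    IntervalIntegrable ((Set.Icc a b).indicator fun _ => k) MeasureTheory.volume
      (-1 / 2 : ℝ) (1 / 2) := by
  rw [intervalIntegrable_iff]
  exact (MeasureTheory.integrableOn_const (by simp [Set.uIoc])).indicator measurableSet_Icc

/-- If `f` does not vanish at `x₀`, multiplying it by the right alternating quotient makes its even
moments essentially integrals of a nonnegative function. The part near `x₀` makes them grow at least
like `ρ ^ (-2n)` with some `ρ < 1/2`, faster than the bound `2 ^ (2n)` permits. -/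
lemma eq_zero_of_abs_lt_half (hol : DifferentiableOn ℂ f upperHalfDisc)
    (smooth : ContDiffOn ℝ ∞ f (closure upperHalfDisc))
    (zeros : ∀ x ∈ Set.Ioo (-1 : ℝ) 1, AccPt x (Filter.principal (realZeros f)) → x = 0)
    (flat : VanishesToInfiniteOrder f upperHalfDisc 0)
    (hre : ∀ x ∈ Set.Ioo (-1 : ℝ) 1, (f x).re = 0 → f x = 0) {x₀ : ℝ} (hx₀ : |x₀| < 1 / 2) :
    f x₀ = 0 := by
  by_contra hfx
  have hf0 := apply_zero_of_flat smooth flat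
  have hx₀I : x₀ ∈ Set.Ioo (-1 : ℝ) 1 := abs_lt.1 (by linarith)
  set c₁ := |(f x₀).re| / 2 with hc₁
  have hc₁0 : 0 < c₁ := half_pos (abs_pos.2 fun h => hfx (hre x₀ hx₀I h))
  obtain ⟨η, hη, hηx, hηc⟩ : ∃ η : ℝ, 0 < η ∧ |x₀| + 2 * η < 1 / 2 ∧
      ∀ x : ℝ, |x - x₀| < 2 * η → c₁ ≤ |(f x).re| := by
    have hcont := ((continuousOn_re_ofReal smooth).continuousAt
      (isOpen_Ioo.mem_nhds hx₀I)).abs.eventually (lt_mem_nhds (half_lt_self (by linarith :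
        0 < |(f x₀).re|)))
    obtain ⟨r, hr, hball⟩ := Metric.eventually_nhds_iff.1 hcont
    refine ⟨min (r / 2) ((1 / 2 - |x₀|) / 4), lt_min (by linarith) (by linarith), ?_, ?_⟩
    · linarith [min_le_right (r / 2) ((1 / 2 - |x₀|) / 4)]
    · intro x hx
      refine (hball ?_).le
      rw [Real.dist_eq]
      linarith [min_le_left (r / 2) ((1 / 2 - |x₀|) / 4)]
  have hfar : ∀ t : ℝ, f t = 0 → 2 * η ≤ |t - x₀| := by
    intro t ht
    by_contra h
    have := hηc t (not_le.1 h)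
    rw [ht, Complex.zero_re, abs_zero] at this
    linarith
  have hx₀η : 2 * η ≤ |x₀| := by simpa using hfar 0 (by simpa using hf0)
  set ρ := |x₀| + η with hρ
  have hρ0 : 0 < ρ := by positivity
  have hρ2 : ρ < 1 / 2 := by linarith
  obtain ⟨A, hA, hmom⟩ := exists_moment_bounds hol smooth flat
  set c := η / 2 * c₁ * (1 / 4 - ρ ^ 2) with hc
  have hc0 : 0 < c := mul_pos (by positivity) (by nlinarith)
  -- `n` is fixed before `δ`: the constant `C` depends on `n`, and `δ` has to be small against it.
  obtain ⟨n, hn⟩ : ∃ n : ℕ, (4 * ρ ^ 2) ^ n < 2 * η * c / (A + 1) :=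
    exists_pow_lt_of_lt_one (by positivity) (by nlinarith)
  obtain ⟨C, hC, hCl⟩ := hmom (2 * n)
  set δ := min η (1 / (2 * C)) with hδ
  have hδ0 : 0 < δ := lt_min hη (by positivity)
  have hδη : δ ≤ η := min_le_left _ _
  have hδC : 2 * δ * C ≤ 1 := by
    have : δ ≤ 1 / (2 * C) := min_le_right _ _
    rw [le_div_iff₀ (by positivity)] at this
    linarith
  obtain ⟨l, σ, hl, hlt, hσ, hsign⟩ := exists_nodeQuotient_sign_re smooth zeros hf0 hre hδ0
  obtain ⟨hbound, hintble, hint⟩ := hCl l hl hlt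
  have hσabs : |σ| = 1 := by rcases hσ with rfl | rfl <;> simp
  set φ : ℝ → ℝ := fun x => σ * (momentIntegrand f l (2 * n) x).re with hφ
  -- Lower bound for the integrand: a positive constant near `x₀`, `-C` on `[-δ, δ]`, where the sign
  -- of the integrand is not controlled, and `0` elsewhere.
  set ψ : ℝ → ℝ := fun x => (Set.Icc (x₀ - η) (x₀ + η)).indicator (fun _ => c / ρ ^ (2 * n)) x -
    (Set.Icc (-δ) δ).indicator (fun _ => C) x with hψ
  have hφeq : ∀ x : ℝ, φ x = (1 / 4 - x ^ 2) / x ^ (2 * n) *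
      (σ * ((f x).re * (nodeQuotient l x).re)) := by
    intro x
    rw [hφ]
    simp only [re_momentIntegrand_ofReal]
    ring
  have hweight : ∀ x : ℝ, |x| ≤ 1 / 2 → 0 ≤ (1 / 4 - x ^ 2) / x ^ (2 * n) := by
    intro x hx
    refine div_nonneg ?_ (by rw [pow_mul]; positivity)
    rw [← sq_abs]
    nlinarith [abs_nonneg x]
  have hle : ∀ x : ℝ, |x| ≤ 1 / 2 → x ≠ 0 → x ∉ l → ψ x ≤ φ x := by
    intro x hx hx0 hxl
    have hJδ : x ∈ Set.Icc (x₀ - η) (x₀ + η) → δ ≤ |x| ∧ |x| ≤ ρ ∧ |x - x₀| ≤ η := by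
      intro hxJ
      have h1 : |x - x₀| ≤ η := abs_le.2 ⟨by linarith [hxJ.1], by linarith [hxJ.2]⟩
      have h2 := abs_sub_abs_le_abs_sub x₀ x
      have h3 := abs_sub_abs_le_abs_sub x x₀
      rw [abs_sub_comm] at h2
      exact ⟨by linarith, by linarith, h1⟩
    have hnonneg : δ ≤ |x| → 0 ≤ φ x := by
      intro hxδ
      rw [hφeq]
      by_cases hfx0 : f x = 0
      · simp [hfx0]
      · exact mul_nonneg (hweight x hx) (hsign x hx hxδ hfx0).le
    by_cases hxJ : x ∈ Set.Icc (x₀ - η) (x₀ + η)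
    · obtain ⟨h1, h2, h3⟩ := hJδ hxJ
      have hψx : ψ x ≤ c / ρ ^ (2 * n) := by
        simp only [hψ, Set.indicator_of_mem hxJ]
        exact sub_le_self _ (Set.indicator_nonneg (fun _ _ => hC.le) _)
      refine hψx.trans ?_
      rw [← abs_of_nonneg (hnonneg h1), hφeq, abs_mul, abs_of_nonneg (hweight x hx), abs_mul,
        hσabs, one_mul, abs_mul]
      have hM : η / 2 ≤ |(nodeQuotient l x).re| := by
        have := (norm_nodeQuotient_mem_Icc (z := x) (m := η / 2) (by positivity) (by linarith) l hl
          (fun t ht => ?_)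
          (fun t ht => norm_sub_ofReal_div_two_le_one (by simp; linarith) (hlt t ht).1)).1
        · have h : nodeQuotient l x = ((nodeQuotient l x).re : ℂ) :=
            Complex.ext rfl (by simp [im_nodeQuotient_ofReal])
          rwa [h, Complex.norm_real, Real.norm_eq_abs] at this
        · rw [← Complex.ofReal_sub, Complex.norm_real, Real.norm_eq_abs]
          have h4 := hfar t (hlt t ht).2
          have h5 := abs_sub_le t x x₀
          rw [abs_sub_comm t x] at h5
          linarith
      have hxρ : x ^ 2 ≤ ρ ^ 2 := sq_le_sq' (by linarith [(abs_le.1 h2).1]) (abs_le.1 h2).2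
      have hxp : x ^ (2 * n) ≤ ρ ^ (2 * n) := by
        rw [pow_mul, pow_mul]; gcongr
      have hxp0 : 0 < x ^ (2 * n) := by rw [pow_mul]; positivity
      calc c / ρ ^ (2 * n) = (1 / 4 - ρ ^ 2) / ρ ^ (2 * n) * (c₁ * (η / 2)) := by rw [hc]; ring
        _ ≤ (1 / 4 - x ^ 2) / x ^ (2 * n) * (|(f x).re| * |(nodeQuotient l x).re|) := by
          gcongr
          · exact hweight x hx
          · nlinarith
          · exact hηc x (by linarith)
    · have hψx : ψ x = -(Set.Icc (-δ) δ).indicator (fun _ => C) x := by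
        simp only [hψ, Set.indicator_of_notMem hxJ, zero_sub]
      rw [hψx]
      by_cases hxδ : x ∈ Set.Icc (-δ) δ
      · rw [Set.indicator_of_mem hxδ]
        have h1 := (Complex.abs_re_le_norm _).trans (hbound x hx hx0 hxl)
        have h2 : |φ x| ≤ C := by simpa only [hφ, abs_mul, hσabs, one_mul] using h1
        exact (abs_le.1 h2).1
      · rw [Set.indicator_of_notMem hxδ, neg_zero]
        refine hnonneg ?_
        by_contra h
        exact hxδ (abs_le.1 (not_le.1 h).le)
  have hφint : IntervalIntegrable φ MeasureTheory.volume (-1 / 2) (1 / 2) := by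
    refine IntervalIntegrable.const_mul ?_ σ
    rw [intervalIntegrable_iff] at hintble ⊢
    exact hintble.re
  have hψint : IntervalIntegrable ψ MeasureTheory.volume (-1 / 2) (1 / 2) :=
    (intervalIntegrable_indicator_Icc _ _ _).sub (intervalIntegrable_indicator_Icc _ _ _)
  have hmono : ∫ x in (-1 / 2 : ℝ)..(1 / 2), ψ x ≤ ∫ x in (-1 / 2 : ℝ)..(1 / 2), φ x := by
    refine intervalIntegral.integral_mono_ae_restrict (by norm_num) hψint hφint ?_
    rw [Filter.EventuallyLE, MeasureTheory.ae_restrict_iff' measurableSet_Icc]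
    have : Set.Finite ({0} ∪ {x | x ∈ l} : Set ℝ) := (Set.finite_singleton 0).union l.finite_toSet
    filter_upwards [this.countable.ae_notMem MeasureTheory.volume] with x hx hxI
    simp only [Set.mem_union, Set.mem_singleton_iff, Set.mem_ofPred_eq, not_or] at hx
    exact hle x (abs_le.2 ⟨by linarith [hxI.1], hxI.2⟩) hx.1 hx.2
  have hφle : ∫ x in (-1 / 2 : ℝ)..(1 / 2), φ x ≤ A * 2 ^ (2 * n) := by
    have h1 : ∫ x in (-1 / 2 : ℝ)..(1 / 2), (momentIntegrand f l (2 * n) x).re =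
        (∫ x in (-1 / 2 : ℝ)..(1 / 2), momentIntegrand f l (2 * n) x).re :=
      Complex.reCLM.intervalIntegral_comp_comm hintble
    rw [hφ, intervalIntegral.integral_const_mul, h1]
    refine (le_abs_self _).trans ?_
    rw [abs_mul, hσabs, one_mul]
    exact (Complex.abs_re_le_norm _).trans hint
  have hψeq : ∫ x in (-1 / 2 : ℝ)..(1 / 2), ψ x = 2 * η * (c / ρ ^ (2 * n)) - 2 * δ * C := by
    have h1 := abs_lt.1 hx₀
    have h2 := le_abs_self x₀
    have h3 := neg_abs_le x₀
    rw [hψ, intervalIntegral.integral_sub (intervalIntegrable_indicator_Icc _ _ _)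
      (intervalIntegrable_indicator_Icc _ _ _),
      integral_indicator_Icc (by linarith) (by linarith) (by linarith),
      integral_indicator_Icc (by linarith) (by linarith) (by linarith)]
    ring
  have hfinal : 2 * η * (c / ρ ^ (2 * n)) ≤ (A + 1) * 2 ^ (2 * n) := by
    have : (1 : ℝ) ≤ 2 ^ (2 * n) := one_le_pow₀ (by norm_num)
    linarith
  rw [lt_div_iff₀ (by positivity), mul_pow] at hn
  rw [← mul_div_assoc, div_le_iff₀ (by positivity), pow_mul, pow_mul] at hfinal
  norm_num at hfinal
  linarith

/-! ### Uniqueness for functions vanishing on an interval of the boundary -/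

/-- On the square centred at `p` with one side on the real axis, the product of `f` with its three
rotations about `p` vanishes on the whole boundary, hence at `p`. -/
lemma eq_zero_of_zero_on_interval (hol : DifferentiableOn ℂ f upperHalfDisc)
    (hcont : ContinuousOn f (closure upperHalfDisc))
    (hzero : ∀ x : ℝ, |x| < 1 / 2 → f x = 0) {p : ℂ} (hp : |p.re| < 1 / 8) (hp0 : 0 < p.im)
    (hp1 : p.im < 1 / 8) : f p = 0 := by
  set c := p.im with hc
  set T : Set ℂ := Set.Ioo (-c) c ×ℂ Set.Ioo (-c) c with hT
  have hTc : closure T = Set.Icc (-c) c ×ℂ Set.Icc (-c) c := by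
    rw [hT, Complex.closure_reProdIm, closure_Ioo (by linarith)]
  set g : ℂ → ℂ := fun u => f (p + u) * f (p + Complex.I * u) * (f (p - u) * f (p - Complex.I * u))
    with hg
  have hsmall : ∀ u : ℂ, |u.re| ≤ c → ‖p + u‖ < 1 ∨ c < |u.im| := by
    intro u hu
    by_cases h : c < |u.im|
    · exact Or.inr h
    · refine Or.inl ((Complex.norm_le_abs_re_add_abs_im _).trans_lt ?_)
      have h1 := abs_add_le p.re u.re
      have h2 := abs_add_le p.im u.im
      rw [abs_of_pos hp0] at h2
      rw [Complex.add_re, Complex.add_im]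
      linarith
  have hmemc : ∀ u : ℂ, |u.re| ≤ c → |u.im| ≤ c → p + u ∈ closure upperHalfDisc := by
    intro u h1 h2
    refine mem_closure_upperHalfDisc ((hsmall u h1).resolve_right (not_lt.2 h2)) ?_
    rw [Complex.add_im]
    linarith [(abs_le.1 h2).1]
  have hmem : ∀ u : ℂ, |u.re| < c → |u.im| < c → p + u ∈ upperHalfDisc := by
    intro u h1 h2
    refine ⟨(hsmall u h1.le).resolve_right (not_lt.2 h2.le), ?_⟩
    rw [Complex.add_im]
    linarith [(abs_lt.1 h2).1]
  have hvan : ∀ u : ℂ, |u.re| ≤ c → u.im = -c → f (p + u) = 0 := by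
    intro u h1 h2
    have e : p + u = ((p.re + u.re : ℝ) : ℂ) := by
      apply Complex.ext <;> simp [h2, ← hc]
    rw [e]
    refine hzero _ ?_
    have := abs_add_le p.re u.re
    linarith
  have hre : ∀ u : ℂ, (Complex.I * u).re = -u.im := by simp
  have him : ∀ u : ℂ, (Complex.I * u).im = u.re := by simp
  have hdiff : DiffContOnCl ℂ g T := by
    constructor
    · intro u hu
      have hu1 : |u.re| < c := abs_lt.2 hu.1
      have hu2 : |u.im| < c := abs_lt.2 hu.2
      have hd : ∀ w : ℂ, w ∈ upperHalfDisc → DifferentiableAt ℂ f w := fun w hw =>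
        hol.differentiableAt (isOpen_upperHalfDisc.mem_nhds hw)
      have d1 : DifferentiableAt ℂ (fun u => f (p + u)) u :=
        (hd _ (hmem u hu1 hu2)).comp u (by fun_prop)
      have d2 : DifferentiableAt ℂ (fun u => f (p + Complex.I * u)) u :=
        (hd _ (hmem (Complex.I * u) (by rwa [hre, abs_neg]) (by rwa [him]))).comp u (by fun_prop)
      have d3 : DifferentiableAt ℂ (fun u => f (p - u)) u :=
        (hd _ (by
          rw [sub_eq_add_neg]
          exact hmem (-u) (by simpa using hu1) (by simpa using hu2))).comp u (by fun_prop)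
      have d4 : DifferentiableAt ℂ (fun u => f (p - Complex.I * u)) u :=
        (hd _ (by
          rw [sub_eq_add_neg]
          exact hmem (-(Complex.I * u)) (by rwa [Complex.neg_re, hre, neg_neg])
            (by rwa [Complex.neg_im, him, abs_neg]))).comp u (by fun_prop)
      exact ((d1.mul d2).mul (d3.mul d4)).differentiableWithinAt
    · rw [hTc]
      have hu : ∀ u ∈ Set.Icc (-c) c ×ℂ Set.Icc (-c) c, |u.re| ≤ c ∧ |u.im| ≤ c :=
        fun u hu => ⟨abs_le.2 hu.1, abs_le.2 hu.2⟩
      refine ((hcont.comp (by fun_prop) fun u h => ?_).mul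
        (hcont.comp (by fun_prop) fun u h => ?_)).mul ((hcont.comp (by fun_prop) fun u h => ?_).mul
        (hcont.comp (by fun_prop) fun u h => ?_))
      · exact hmemc u (hu u h).1 (hu u h).2
      · exact hmemc _ (by rw [hre, abs_neg]; exact (hu u h).2) (by rw [him]; exact (hu u h).1)
      · rw [sub_eq_add_neg]
        exact hmemc _ (by simpa using (hu u h).1) (by simpa using (hu u h).2)
      · rw [sub_eq_add_neg]
        exact hmemc _ (by rw [Complex.neg_re, hre, neg_neg]; exact (hu u h).2)
          (by rw [Complex.neg_im, him, abs_neg]; exact (hu u h).1)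
  have hbdd : Bornology.IsBounded T :=
    (Metric.isBounded_Ioo _ _).reProdIm (Metric.isBounded_Ioo _ _)
  have hfr : ∀ u ∈ frontier T, ‖g u‖ ≤ 0 := by
    intro u hu
    have hopen : IsOpen T := isOpen_Ioo.reProdIm isOpen_Ioo
    rw [hopen.frontier_eq, hTc] at hu
    have hu1 : |u.re| ≤ c := abs_le.2 hu.1.1
    have hu2 : |u.im| ≤ c := abs_le.2 hu.1.2
    have hcases : u.im = -c ∨ u.re = -c ∨ u.im = c ∨ u.re = c := by
      by_contra hno
      push Not at hno
      exact hu.2 ⟨⟨lt_of_le_of_ne hu.1.1.1 hno.2.1.symm, lt_of_le_of_ne hu.1.1.2 hno.2.2.2⟩,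
        ⟨lt_of_le_of_ne hu.1.2.1 hno.1.symm, lt_of_le_of_ne hu.1.2.2 hno.2.2.1⟩⟩
    rw [norm_le_zero_iff, hg]
    rcases hcases with h | h | h | h
    · simp [hvan u hu1 h]
    · simp [hvan (Complex.I * u) (by rwa [hre, abs_neg]) (by rw [him, h])]
    · have := hvan (-u) (by simpa using hu1) (by simp [h])
      simp [sub_eq_add_neg, this]
    · have := hvan (-(Complex.I * u)) (by rwa [Complex.neg_re, hre, neg_neg])
        (by rw [Complex.neg_im, him, h])
      simp [sub_eq_add_neg, this]
  have h0 : (0 : ℂ) ∈ closure T := by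
    rw [hTc]; constructor <;> simp [hp0.le]
  have := Complex.norm_le_of_forall_mem_frontier_norm_le hbdd hdiff hfr h0
  rw [norm_le_zero_iff, hg] at this
  simpa using this

lemma eq_zero_of_zero_on_boundary_interval (hol : DifferentiableOn ℂ f upperHalfDisc)
    (hcont : ContinuousOn f (closure upperHalfDisc))
    (hzero : ∀ x : ℝ, |x| < 1 / 2 → f x = 0) {z : ℂ} (hz : z ∈ closure upperHalfDisc) :
    f z = 0 := by
  have hI : Complex.I / 16 ∈ upperHalfDisc := by constructor <;> norm_num
  have hev : f =ᶠ[nhds (Complex.I / 16)] 0 := by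
    have h1 : ∀ᶠ p : ℂ in nhds (Complex.I / 16), |p.re| < 1 / 8 :=
      (Complex.continuous_re.abs.continuousAt).eventually_lt_const (by simp)
    have h2 : ∀ᶠ p : ℂ in nhds (Complex.I / 16), 0 < p.im :=
      Complex.continuous_im.continuousAt.eventually_const_lt hI.2
    have h3 : ∀ᶠ p : ℂ in nhds (Complex.I / 16), p.im < 1 / 8 :=
      Complex.continuous_im.continuousAt.eventually_lt_const (by norm_num)
    filter_upwards [h1, h2, h3] with p hp1 hp2 hp3
    exact eq_zero_of_zero_on_interval hol hcont hzero hp1 hp2 hp3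
  have hΩ : Set.EqOn f 0 upperHalfDisc :=
    (hol.analyticOnNhd isOpen_upperHalfDisc).eqOn_zero_of_preconnected_of_eventuallyEq_zero
      convex_upperHalfDisc.isPreconnected hI hev
  have := mem_closure_iff_nhdsWithin_neBot.1 hz
  refine tendsto_nhds_unique
    ((hcont z hz).tendsto.mono_left (nhdsWithin_mono _ subset_closure)) ?_
  exact tendsto_const_nhds.congr' (Filter.eventuallyEq_of_mem self_mem_nhdsWithin
    fun w hw => (hΩ hw).symm)

/-! ### The line through the origin -/

/-- A line through the origin is `{w | Re (c * w) = 0}` for some `c ≠ 0`, so multiplying `f` by `c`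
rotates it to the imaginary axis. -/
lemma eq_zero_of_re_mul_ne_zero (hol : DifferentiableOn ℂ f upperHalfDisc)
    (smooth : ContDiffOn ℝ ∞ f (closure upperHalfDisc))
    (zeros : ∀ x ∈ Set.Ioo (-1 : ℝ) 1, AccPt x (Filter.principal (realZeros f)) → x = 0)
    (flat : VanishesToInfiniteOrder f upperHalfDisc 0) {c : ℂ} (hc : c ≠ 0)
    (hre : ∀ x ∈ Set.Ioo (-1 : ℝ) 1, (c * f x).re = 0 → f x = 0) {z : ℂ}
    (hz : z ∈ closure upperHalfDisc) : f z = 0 := by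
  refine eq_zero_of_zero_on_boundary_interval hol smooth.continuousOn (fun x hx => ?_) hz
  have hzeros : realZeros (fun z => c * f z) = realZeros f := by
    ext x; simp [realZeros, hc]
  have hflat : VanishesToInfiniteOrder (fun z => c * f z) upperHalfDisc 0 := by
    intro N
    simpa [mul_div_assoc] using (flat N).const_mul c
  have := eq_zero_of_abs_lt_half (f := fun z => c * f z) (hol.const_mul c)
    (contDiffOn_const.mul smooth) (by rwa [hzeros]) hflat
    (fun x hx h => by rw [hre x hx h, mul_zero]) hx
  exact (mul_eq_zero.1 this).resolve_left hc

lemma exists_forall_re_mul_eq_zero_imp_mem (L : Submodule ℝ ℂ) (hL : Module.finrank ℝ L = 1) :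
    ∃ c : ℂ, c ≠ 0 ∧ ∀ w : ℂ, (c * w).re = 0 → w ∈ L := by
  obtain ⟨⟨v, hvL⟩, hv, -⟩ := finrank_eq_one_iff'.1 hL
  have hv0 : v ≠ 0 := fun h => hv (Subtype.ext h)
  refine ⟨Complex.I * (starRingEnd ℂ) v, by simpa using hv0, fun w hw => ?_⟩
  have h1 : ((starRingEnd ℂ) v * w).im = 0 := by
    rw [mul_assoc, Complex.I_mul_re] at hw
    exact neg_eq_zero.1 hw
  have h2 : w = (((starRingEnd ℂ) v * w).re / Complex.normSq v) • v := by
    have h3 : (starRingEnd ℂ) v * w = (((starRingEnd ℂ) v * w).re : ℂ) :=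
      Complex.ext rfl (by simpa using h1)
    rw [Complex.real_smul]
    push_cast
    rw [← h3, Complex.normSq_eq_conj_mul_self]
    have : (starRingEnd ℂ) v ≠ 0 := by simpa using hv0
    field_simp
  rw [h2]
  exact L.smul_mem _ hvL

end BoundaryUnique

theorem theorem1p3 (f : ℂ → ℂ)
    (hol : DifferentiableOn ℂ f BoundaryUnique.upperHalfDisc)
    (smooth : ContDiffOn ℝ ∞ f (closure BoundaryUnique.upperHalfDisc))
    (zeros : ∀ x ∈ Set.Ioo (-1 : ℝ) 1,
      AccPt x (Filter.principal (BoundaryUnique.realZeros f)) → x = 0)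
    (flat : BoundaryUnique.VanishesToInfiniteOrder f BoundaryUnique.upperHalfDisc 0) :
    ((∀ x ∈ Set.Ioo (-1 : ℝ) 1, f (x : ℂ) ∈ BoundaryUnique.gammaInfty) →
      ∀ z ∈ closure BoundaryUnique.upperHalfDisc, f z = 0) ∧
    (∀ L : Submodule ℝ ℂ, Module.finrank ℝ L = 1 →
      (∀ x ∈ Set.Ioo (-1 : ℝ) 1, f (x : ℂ) ∈ ((L : Set ℂ)ᶜ ∪ {0} : Set ℂ)) →
      ∀ z ∈ closure BoundaryUnique.upperHalfDisc, f z = 0) := by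
  refine ⟨fun h z hz => ?_, fun L hL h z hz => ?_⟩
  · refine BoundaryUnique.eq_zero_of_re_mul_ne_zero hol smooth zeros flat one_ne_zero
      (fun x hx hx0 => ?_) hz
    rw [one_mul] at hx0
    exact (h x hx).resolve_left (not_not.2 hx0)
  · obtain ⟨c, hc, hcL⟩ := BoundaryUnique.exists_forall_re_mul_eq_zero_imp_mem L hL
    exact BoundaryUnique.eq_zero_of_re_mul_ne_zero hol smooth zeros flat hc
      (fun x hx hx0 => (h x hx).resolve_left (not_not.2 (hcL _ hx0))) hz
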